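/- All functions are complex-valued. For a probability space $(T,m)$, a bounded set $S\subset L_\infty(T,m)$ is called Sidon with constant $C$ if $\sum_{\varphi\in S}|x(\varphi)|\le C\,\bigl\|\sum_{\varphi\in S}x(\varphi)\varphi\bigr\|_\infty$ for every finitely supported $x:S\to\mathbb C$. It is called $\otimes^4$-Sidon with constant $C$ if the system $(\varphi\otimes\varphi\otimes\varphi\otimes\varphi)_{\varphi\in S}$, where $(\varphi\otimes\varphi\otimes\varphi\otimes\varphi)(t_1,t_2,t_3,t_4)=\varphi(t_1)\varphi(t_2)\varphi(t_3)\varphi(t_4)$, satisfies the same inequality in $L_\infty(T^4,m\times m\times m\times m)$, that is, $\sum_{\varphi\in S}|x(\varphi)|\le C\,\bigl\|\sum_{\varphi\in S}x(\varphi)\,\varphi\otimes\varphi\otimes\varphi\otimes\varphi\bigr\|_\infty$ for every finitely supported $x:S\to\mathbb C$. **Theorem.** Let $C_1,C_2$ be real numbers and $C'_1,C'_2,\delta>0$. There is a constant $C$, depending only on $C_1,C_2,C'_1,C'_2,\delta$, such that the following holds for every probability space $(T,m)$. Let $\Lambda_1,\Lambda_2\subset L_\infty(T,m)$ be Sidon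 sets with constants $C_1$ and $C_2$ respectively. Assume that $\Lambda_1\perp\Lambda_2$ in $L_2(m)$, i.e. $\int\varphi\,\overline{\psi}\,dm=0$ for all $\varphi\in\Lambda_1$, $\psi\in\Lambda_2$, and that for $j=1,2$ $$\delta\le\|\varphi\|_2\le\|\varphi\|_\infty\le C'_j\qquad\text{for all }\varphi\in\Lambda_j .$$ Then the union $\Lambda_1\cup\Lambda_2$ is $\otimes^4$-Sidon with constant $C$. -/

import Mathlib

open scoped ENNReal ComplexConjugate
open MeasureTheory

noncomputable section

namespace SidonSystem

/-- The function `(t₁, …, t_k) ↦ f t₁ ⋯ f t_k` attached to a (class of a) function `f`. -/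
def tensorPowFun {T : Type*} (k : ℕ) (f : T → ℂ) : (Fin k → T) → ℂ :=
  fun t => ∏ i, f (t i)

theorem memLp_tensorPowFun {T : Type*} [MeasurableSpace T] {m : Measure T}
    [IsProbabilityMeasure m] (k : ℕ) (φ : Lp ℂ ∞ m) :
    MemLp (tensorPowFun k φ) ∞ (Measure.pi fun _ : Fin k => m) := by
  have hmp : ∀ i : Fin k,
      MeasurePreserving (Function.eval i) (Measure.pi fun _ : Fin k => m) m :=
    fun i => measurePreserving_eval (fun _ : Fin k => m) i
  have hb : ∀ᵐ t ∂m, ‖φ t‖ ≤ ‖φ‖ := by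
    have h := ae_le_eLpNormEssSup (f := (φ : T → ℂ)) (μ := m)
    filter_upwards [h] with t ht
    have hfin : eLpNormEssSup (φ : T → ℂ) m ≠ ∞ := by
      rw [← eLpNorm_exponent_top]
      exact Lp.eLpNorm_ne_top φ
    rw [Lp.norm_def, eLpNorm_exponent_top, ← toReal_enorm]
    exact ENNReal.toReal_mono hfin ht
  refine memLp_top_of_bound (C := ‖φ‖ ^ k) ?_ ?_
  · unfold tensorPowFun
    refine Finset.aestronglyMeasurable_fun_prod _ fun i _ => ?_
    exact (Lp.aestronglyMeasurable φ).comp_quasiMeasurePreserving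
      (hmp i).quasiMeasurePreserving
  · have hall : ∀ᵐ t ∂(Measure.pi fun _ : Fin k => m), ∀ i : Fin k, ‖φ (t i)‖ ≤ ‖φ‖ :=
      ae_all_iff.2 fun i => (hmp i).quasiMeasurePreserving.ae hb
    filter_upwards [hall] with t ht
    calc ‖tensorPowFun k φ t‖ = ∏ i, ‖φ (t i)‖ := by simp [tensorPowFun, norm_prod]
      _ ≤ ∏ _i : Fin k, ‖φ‖ := Finset.prod_le_prod (fun _ _ => norm_nonneg _) fun i _ => ht i
      _ = ‖φ‖ ^ k := by simp

/-- The tensor power `φ ⊗ ⋯ ⊗ φ` (`k` factors) of `φ ∈ L_∞(T, m)`, as an element of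
`L_∞(T^k, m × ⋯ × m)`. -/
def tensorPow {T : Type*} [MeasurableSpace T] {m : Measure T} [IsProbabilityMeasure m]
    (k : ℕ) (φ : Lp ℂ ∞ m) : Lp ℂ ∞ (Measure.pi fun _ : Fin k => m) :=
  (memLp_tensorPowFun k φ).toLp (tensorPowFun k φ)

/-- A family `(f i)` in `L_∞(T, m)` is Sidon with constant `C` if
`∑ |x i| ≤ C ‖∑ x i • f i‖_∞` for all finitely supported complex coefficients `x`. -/
def IsSidonFamily {T : Type*} [MeasurableSpace T] {m : Measure T} {ι : Type*}
    (f : ι → Lp ℂ ∞ m) (C : ℝ) : Prop :=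
  ∀ x : ι →₀ ℂ, ∑ i ∈ x.support, ‖x i‖ ≤ C * ‖∑ i ∈ x.support, x i • f i‖

/-- A bounded subset `S` of `L_∞(T, m)` is Sidon with constant `C`. -/
def IsSidonSet {T : Type*} [MeasurableSpace T] {m : Measure T}
    (S : Set (Lp ℂ ∞ m)) (C : ℝ) : Prop :=
  Bornology.IsBounded S ∧ IsSidonFamily (fun φ : S => (φ : Lp ℂ ∞ m)) C

/-- A bounded subset `S` of `L_∞(T, m)` is `⊗^k`-Sidon with constant `C`: the system
`(φ ⊗ ⋯ ⊗ φ)` indexed by `φ ∈ S` is Sidon with constant `C` in `L_∞(T^k, m × ⋯ × m)`. -/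
def IsTensorSidonSet {T : Type*} [MeasurableSpace T] {m : Measure T} [IsProbabilityMeasure m]
    (k : ℕ) (S : Set (Lp ℂ ∞ m)) (C : ℝ) : Prop :=
  Bornology.IsBounded S ∧ IsSidonFamily (fun φ : S => tensorPow k (φ : Lp ℂ ∞ m)) C

/-- Two subsets of `L_∞(T, m)` are mutually orthogonal in `L_2(m)`. The integrand is bounded,
hence integrable for a finite measure. -/
def MutuallyOrthogonal {T : Type*} [MeasurableSpace T] {m : Measure T}
    (S S' : Set (Lp ℂ ∞ m)) : Prop :=
  ∀ φ ∈ S, ∀ ψ ∈ S', ∫ t, φ t * conj (ψ t) ∂m = 0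

end SidonSystem

end

/-! Fix a finite part `s₁` of one Sidon set. Sidon duality (`exists_pairing_eq`) yields, for every
sign vector ε on `s₁`, a function f_ε of L₁ norm below C + 1 whose pairings with the elements of
`s₁` are the signs ε_i. For any φ put u_φ(ε) = ∫ f_ε φ: this is a coordinate sign if φ ∈ `s₁`, and
merely a bounded function otherwise.

Two of the four variables are tested against f_ε ⊗ f_ε', averaged over (ε, ε') with a kernel whose
coefficients b_i depend on the other two variables through conj φ_i ⊗ conj φ_i. The kernel is the
odd part of a Riesz product, divided by its small parameter η. Its mass is O(1/η), and against u ⊗ u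
it gives ∑ b_i û({i})² up to O(η²), by Parseval. Integrating out the last two variables turns b_i
into a multiple of ⟨φ, φ_i⟩². On the other Sidon set this vanishes by orthogonality; on `s₁` only
the diagonal survives because û_φ is known there.

Hence (`sum_norm_le_norm_sum_tensorPow_add`) the coefficients on `s₁` are bounded by O(1/η) times
the tensor norm plus O(η²) times the sum of all coefficients. Adding the symmetric estimate and
taking η small absorbs the last term. -/

noncomputable section

namespace SidonSystem

/-! ### Riesz products on the group of signs -/

section Riesz

variable {ι : Type*}

/-- The sign `±1` attached to a Boolean. -/
def sgn (b : Bool) : ℝ := if b then 1 else -1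

@[simp] lemma sgn_true : sgn true = 1 := rfl

@[simp] lemma sgn_false : sgn false = -1 := rfl

@[simp] lemma abs_sgn (b : Bool) : |sgn b| = 1 := by cases b <;> simp

/-- The Walsh function `ε ↦ ∏_{i ∈ A} ε i`. -/
def walsh (A : Finset ι) (ε : ι → Bool) : ℝ := ∏ i ∈ A, sgn (ε i)

variable [Fintype ι]

/-- The Riesz product `∏ i, (1 + b i ε i ε' i)`. -/
def riesz (b : ι → ℝ) (ε ε' : ι → Bool) : ℝ := ∏ i, (1 + b i * (sgn (ε i) * sgn (ε' i)))

lemma riesz_eq_sum (b : ι → ℝ) (ε ε' : ι → Bool) :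
    riesz b ε ε' = ∑ A : Finset ι, (∏ i ∈ A, b i) * (walsh A ε * walsh A ε') := by
  simp only [riesz, walsh, Finset.prod_one_add, Finset.prod_mul_distrib, Finset.powerset_univ]

lemma riesz_nonneg {b : ι → ℝ} (hb : ∀ i, |b i| ≤ 1) (ε ε' : ι → Bool) : 0 ≤ riesz b ε ε' := by
  refine Finset.prod_nonneg fun i _ => ?_
  have h : |b i * (sgn (ε i) * sgn (ε' i))| ≤ 1 := by simpa [abs_mul] using hb i
  linarith [neg_le_of_abs_le h]

/-- This is the completeness of the Walsh system, used for Parseval. -/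
lemma riesz_one [DecidableEq ι] (ε ε' : ι → Bool) :
    riesz (fun _ => 1) ε ε' = if ε = ε' then 2 ^ Fintype.card ι else 0 := by
  split_ifs with h
  · subst h
    rw [riesz, ← Finset.card_univ, ← Finset.prod_const]
    refine Finset.prod_congr rfl fun i _ => ?_
    cases ε i <;> norm_num
  · obtain ⟨i, hi⟩ := Function.ne_iff.1 h
    refine Finset.prod_eq_zero (Finset.mem_univ i) ?_
    revert hi
    cases ε i <;> cases ε' i <;> simp

lemma sum_eq_sum_singleton_add {M : Type*} [AddCommMonoid M]
    (g : Finset ι → M) :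
    ∑ A, g A = ∑ i, g {i} + ∑ A with A.card ≠ 1, g A := by
  rw [← Finset.sum_filter_add_sum_filter_not Finset.univ (fun A : Finset ι => A.card = 1)]
  congr 1
  symm
  refine Finset.sum_bij (fun i _ => {i}) (by simp) (by simp) ?_ (by simp)
  intro A hA
  obtain ⟨i, rfl⟩ := Finset.card_eq_one.1 (Finset.mem_filter.1 hA).2
  exact ⟨i, Finset.mem_univ i, rfl⟩

/-- The odd part of the Riesz product with coefficients `η b i`, divided by `η`. -/
def oddRiesz (η : ℝ) (b : ι → ℝ) (ε ε' : ι → Bool) : ℝ :=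
  (2 * η)⁻¹ * (riesz (fun i => η * b i) ε ε' - riesz (fun i => -η * b i) ε ε')

/-- The complex version of `oddRiesz`, treating real and imaginary parts separately. -/
def rieszKernel (η : ℝ) (b : ι → ℂ) (ε ε' : ι → Bool) : ℂ :=
  oddRiesz η (fun i => (b i).re) ε ε' + Complex.I * oddRiesz η (fun i => (b i).im) ε ε'

lemma continuous_rieszKernel (η : ℝ) (ε ε' : ι → Bool) :
    Continuous fun b : ι → ℂ => rieszKernel η b ε ε' := by
  unfold rieszKernel oddRiesz riesz
  fun_prop

variable [DecidableEq ι]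

/-- The Fourier–Walsh coefficient of `u` at `A`. -/
def walshCoeff (u : (ι → Bool) → ℂ) (A : Finset ι) : ℂ :=
  (2 ^ Fintype.card ι : ℂ)⁻¹ * ∑ ε, (walsh A ε : ℂ) * u ε

/-- Each factor averages to one over its own sign. With `riesz_nonneg`, this makes a Riesz product a
probability density, whatever the number of signs. -/
lemma sum_riesz (b : ι → ℝ) (ε' : ι → Bool) :
    ∑ ε, riesz b ε ε' = 2 ^ Fintype.card ι := by
  have h := Finset.sum_prod_piFinset (Finset.univ : Finset Bool)
    (fun i e => 1 + b i * (sgn e * sgn (ε' i)))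
  simp only [Fintype.piFinset_univ] at h
  simp only [riesz, h, Fintype.sum_bool, sgn_true, sgn_false]
  rw [← Finset.card_univ, ← Finset.prod_const]
  exact Finset.prod_congr rfl fun i _ => by ring

/-- Integrating a Riesz product against `u ⊗ u` gives a sum of squared Walsh coefficients. -/
lemma sum_riesz_mul (b : ι → ℝ) (u : (ι → Bool) → ℂ) :
    (2 ^ Fintype.card ι : ℂ)⁻¹ ^ 2 * ∑ ε, ∑ ε', (riesz b ε ε' : ℂ) * (u ε * u ε') =
      ∑ A : Finset ι, ((∏ i ∈ A, b i : ℝ) : ℂ) * walshCoeff u A ^ 2 := by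
  have h : ∀ A : Finset ι, ((∏ i ∈ A, b i : ℝ) : ℂ) * walshCoeff u A ^ 2 =
      (2 ^ Fintype.card ι : ℂ)⁻¹ ^ 2 * ∑ ε, ∑ ε', ((∏ i ∈ A, b i : ℝ) : ℂ) *
        ((walsh A ε : ℂ) * (walsh A ε' : ℂ)) * (u ε * u ε') := by
    intro A
    rw [walshCoeff, mul_pow, sq (∑ ε, _), Finset.sum_mul_sum, mul_left_comm, Finset.mul_sum]
    congr 1
    refine Finset.sum_congr rfl fun ε _ => ?_
    rw [Finset.mul_sum]
    exact Finset.sum_congr rfl fun ε' _ => by ring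
  rw [Finset.sum_congr rfl fun A _ => h A, ← Finset.mul_sum]
  congr 1
  conv_rhs => rw [Finset.sum_comm]
  refine Finset.sum_congr rfl fun ε _ => ?_
  conv_rhs => rw [Finset.sum_comm]
  refine Finset.sum_congr rfl fun ε' _ => ?_
  rw [riesz_eq_sum, Complex.ofReal_sum, Finset.sum_mul]
  exact Finset.sum_congr rfl fun A _ => by push_cast; ring

/-- Parseval's identity, as an inequality for bounded functions. -/
lemma sum_norm_walshCoeff_sq_le {u : (ι → Bool) → ℂ} {B : ℝ} (hu : ∀ ε, ‖u ε‖ ≤ B) :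
    ∑ A, ‖walshCoeff u A‖ ^ 2 ≤ B ^ 2 := by
  set N : ℝ := 2 ^ Fintype.card ι with hN
  have hN0 : 0 < N := by positivity
  have h : ((∑ A, ‖walshCoeff u A‖ ^ 2 : ℝ) : ℂ) = ((N⁻¹ * ∑ ε, ‖u ε‖ ^ 2 : ℝ) : ℂ) := by
    have h1 : ∀ A : Finset ι, ((‖walshCoeff u A‖ ^ 2 : ℝ) : ℂ) =
        (N : ℂ)⁻¹ ^ 2 * ∑ ε, ∑ ε', ((walsh A ε * walsh A ε' : ℝ) : ℂ) * (u ε * conj (u ε')) := by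
      intro A
      rw [Complex.ofReal_pow, ← Complex.mul_conj', walshCoeff, map_mul, map_sum, mul_mul_mul_comm,
        Finset.sum_mul_sum]
      simp only [map_inv₀, map_pow, map_mul, Complex.conj_ofReal, hN]
      push_cast
      rw [sq, map_ofNat]
      congr 1
      exact Finset.sum_congr rfl fun ε _ => Finset.sum_congr rfl fun ε' _ => by ring
    rw [Complex.ofReal_sum, Finset.sum_congr rfl fun A _ => h1 A, ← Finset.mul_sum,
      Finset.sum_comm]
    have h2 : ∀ ε, ∑ A : Finset ι, ∑ ε', ((walsh A ε * walsh A ε' : ℝ) : ℂ) *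
        (u ε * conj (u ε')) = N * ((‖u ε‖ ^ 2 : ℝ) : ℂ) := by
      intro ε
      rw [Finset.sum_comm]
      have h3 : ∀ ε', ∑ A : Finset ι, ((walsh A ε * walsh A ε' : ℝ) : ℂ) * (u ε * conj (u ε')) =
          if ε = ε' then (N : ℂ) * (u ε * conj (u ε')) else 0 := by
        intro ε'
        have h4 := riesz_eq_sum (fun _ => 1) ε ε'
        simp only [Finset.prod_const_one, one_mul] at h4
        rw [← Finset.sum_mul, ← Complex.ofReal_sum, ← h4, riesz_one]
        split_ifs <;> simp [hN]
      rw [Finset.sum_congr rfl fun ε' _ => h3 ε', Finset.sum_ite_eq, if_pos (Finset.mem_univ _),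
        Complex.mul_conj']
      push_cast
      rfl
    rw [Finset.sum_congr rfl fun ε _ => h2 ε, ← Finset.mul_sum]
    have : (N : ℂ) ≠ 0 := by exact_mod_cast hN0.ne'
    push_cast
    field_simp
  rw [Complex.ofReal_inj.1 h, inv_mul_le_iff₀ hN0]
  calc ∑ ε, ‖u ε‖ ^ 2 ≤ ∑ _ε : ι → Bool, B ^ 2 :=
        Finset.sum_le_sum fun ε _ => by gcongr; exact hu ε
    _ = N * B ^ 2 := by simp [hN]

/-- Both Riesz products in the difference are nonnegative with mean one, so the triangle inequality
costs only 2 · (2η)⁻¹. -/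
lemma sum_abs_oddRiesz_le {η : ℝ} (h0 : 0 < η) (h1 : η ≤ 1) {b : ι → ℝ} (hb : ∀ i, |b i| ≤ 1) :
    ∑ ε, ∑ ε', |oddRiesz η b ε ε'| ≤ (2 ^ Fintype.card ι) ^ 2 * η⁻¹ := by
  have hle : ∀ i, |η * b i| ≤ 1 := fun i => by
    rw [abs_mul, abs_of_pos h0]; exact mul_le_one₀ h1 (abs_nonneg _) (hb i)
  have hle' : ∀ i, |-η * b i| ≤ 1 := fun i => by rw [neg_mul, abs_neg]; exact hle i
  have hpt : ∀ ε ε', |oddRiesz η b ε ε'| ≤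
      (2 * η)⁻¹ * (riesz (fun i => η * b i) ε ε' + riesz (fun i => -η * b i) ε ε') := by
    intro ε ε'
    rw [oddRiesz, abs_mul, abs_of_pos (by positivity)]
    gcongr
    have := riesz_nonneg hle ε ε'
    have := riesz_nonneg hle' ε ε'
    rw [abs_le]; constructor <;> linarith
  rw [Finset.sum_comm]
  calc ∑ ε', ∑ ε, |oddRiesz η b ε ε'|
      ≤ ∑ ε', ∑ ε, (2 * η)⁻¹ *
        (riesz (fun i => η * b i) ε ε' + riesz (fun i => -η * b i) ε ε') :=
        Finset.sum_le_sum fun ε' _ => Finset.sum_le_sum fun ε _ => hpt ε ε'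
    _ = (2 ^ Fintype.card ι) ^ 2 * η⁻¹ := by
        simp only [← Finset.mul_sum, Finset.sum_add_distrib, sum_riesz]
        simp
        field_simp
        ring

/-- Even powers cancel, and an odd n ≠ 1 is at least 3, leaving η ^ (n - 1) ≤ η ^ 2. -/
lemma abs_odd_pow_le {η : ℝ} (h0 : 0 < η) (h1 : η ≤ 1) {n : ℕ} (hn : n ≠ 1) :
    |(2 * η)⁻¹ * (η ^ n - (-η) ^ n)| ≤ η ^ 2 := by
  rcases Nat.even_or_odd n with he | ho
  · simp [he.neg_pow]; positivity
  · obtain ⟨k, rfl⟩ := ho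
    obtain ⟨j, rfl⟩ : ∃ j, k = j + 1 := Nat.exists_eq_succ_of_ne_zero (by omega)
    have : (2 * η)⁻¹ * (η ^ (2 * (j + 1) + 1) - (-η) ^ (2 * (j + 1) + 1)) = η ^ 2 * η ^ (2 * j) := by
      rw [(odd_two_mul_add_one (j + 1)).neg_pow]
      field_simp
      ring
    rw [this, abs_of_nonneg (by positivity)]
    exact mul_le_of_le_one_right (by positivity) (pow_le_one₀ h0.le h1)

/-- In the Walsh expansion the singletons keep exactly the coefficients b_i; all others are at most
η², and Parseval sums them. The error is small although nothing but boundedness is known about u. -/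
lemma norm_sum_oddRiesz_sub_le {η : ℝ} (h0 : 0 < η) (h1 : η ≤ 1) {b : ι → ℝ}
    (hb : ∀ i, |b i| ≤ 1) {u : (ι → Bool) → ℂ} {B : ℝ} (hu : ∀ ε, ‖u ε‖ ≤ B) :
    ‖(2 ^ Fintype.card ι : ℂ)⁻¹ ^ 2 * ∑ ε, ∑ ε', (oddRiesz η b ε ε' : ℂ) * (u ε * u ε') -
      ∑ i, (b i : ℂ) * walshCoeff u {i} ^ 2‖ ≤ η ^ 2 * B ^ 2 := by
  set c : Finset ι → ℝ := fun A =>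
    (2 * η)⁻¹ * (η ^ A.card - (-η) ^ A.card) * ∏ i ∈ A, b i with hc
  have hexp : (2 ^ Fintype.card ι : ℂ)⁻¹ ^ 2 *
      ∑ ε, ∑ ε', (oddRiesz η b ε ε' : ℂ) * (u ε * u ε') =
      ∑ A, (c A : ℂ) * walshCoeff u A ^ 2 := by
    have hsplit : ∑ A, (c A : ℂ) * walshCoeff u A ^ 2 = ((2 * η : ℝ) : ℂ)⁻¹ *
        (∑ A : Finset ι, ((∏ i ∈ A, (η * b i) : ℝ) : ℂ) * walshCoeff u A ^ 2 -
          ∑ A : Finset ι, ((∏ i ∈ A, (-η * b i) : ℝ) : ℂ) * walshCoeff u A ^ 2) := by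
      rw [← Finset.sum_sub_distrib, Finset.mul_sum]
      refine Finset.sum_congr rfl fun A _ => ?_
      simp only [hc, Finset.prod_mul_distrib, Finset.prod_const]
      push_cast
      ring
    rw [hsplit, ← sum_riesz_mul, ← sum_riesz_mul, ← mul_sub, ← Finset.sum_sub_distrib,
      mul_left_comm]
    congr 1
    rw [Finset.mul_sum]
    refine Finset.sum_congr rfl fun ε _ => ?_
    rw [← Finset.sum_sub_distrib, Finset.mul_sum]
    refine Finset.sum_congr rfl fun ε' _ => ?_
    rw [oddRiesz]
    push_cast
    ring
  have hc1 : ∀ i, c {i} = b i := fun i => by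
    simp only [hc, Finset.card_singleton, Finset.prod_singleton]
    field_simp
    ring
  rw [hexp, sum_eq_sum_singleton_add]
  simp only [hc1, add_sub_cancel_left]
  calc ‖∑ A with A.card ≠ 1, (c A : ℂ) * walshCoeff u A ^ 2‖
      ≤ ∑ A with A.card ≠ 1, η ^ 2 * ‖walshCoeff u A‖ ^ 2 := by
        refine norm_sum_le_of_le _ fun A hA => ?_
        rw [norm_mul, norm_pow, Complex.norm_real, Real.norm_eq_abs]
        gcongr
        rw [hc, abs_mul, Finset.abs_prod]
        calc _ ≤ η ^ 2 * 1 := by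
              gcongr
              · exact abs_odd_pow_le h0 h1 (Finset.mem_filter.1 hA).2
              · exact Finset.prod_le_one (fun _ _ => abs_nonneg _) fun i _ => hb i
          _ = η ^ 2 := mul_one _
    _ ≤ ∑ A, η ^ 2 * ‖walshCoeff u A‖ ^ 2 :=
        Finset.sum_le_sum_of_subset_of_nonneg (Finset.subset_univ _) fun _ _ _ => by positivity
    _ ≤ η ^ 2 * B ^ 2 := by
        rw [← Finset.mul_sum]
        gcongr
        exact sum_norm_walshCoeff_sq_le hu

/-- Positivity of Riesz products needs real coefficients; treating real and imaginary parts
separately costs a factor 2. -/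
lemma sum_norm_rieszKernel_le {η : ℝ} (h0 : 0 < η) (h1 : η ≤ 1) {b : ι → ℂ}
    (hb : ∀ i, ‖b i‖ ≤ 1) :
    ∑ ε, ∑ ε', ‖rieszKernel η b ε ε'‖ ≤ (2 ^ Fintype.card ι) ^ 2 * (2 * η⁻¹) := by
  have hre := sum_abs_oddRiesz_le h0 h1 fun i => (Complex.abs_re_le_norm (b i)).trans (hb i)
  have him := sum_abs_oddRiesz_le h0 h1 fun i => (Complex.abs_im_le_norm (b i)).trans (hb i)
  calc ∑ ε, ∑ ε', ‖rieszKernel η b ε ε'‖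
      ≤ ∑ ε, ∑ ε', (|oddRiesz η (fun i => (b i).re) ε ε'| +
          |oddRiesz η (fun i => (b i).im) ε ε'|) := by
        refine Finset.sum_le_sum fun ε _ => Finset.sum_le_sum fun ε' _ => ?_
        refine (norm_add_le _ _).trans_eq ?_
        simp
    _ ≤ _ := by
        simp only [Finset.sum_add_distrib]
        linarith

lemma norm_sum_rieszKernel_sub_le {η : ℝ} (h0 : 0 < η) (h1 : η ≤ 1) {b : ι → ℂ}
    (hb : ∀ i, ‖b i‖ ≤ 1) {u : (ι → Bool) → ℂ} {B : ℝ} (hu : ∀ ε, ‖u ε‖ ≤ B) :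
    ‖(2 ^ Fintype.card ι : ℂ)⁻¹ ^ 2 * ∑ ε, ∑ ε', rieszKernel η b ε ε' * (u ε * u ε') -
      ∑ i, b i * walshCoeff u {i} ^ 2‖ ≤ 2 * η ^ 2 * B ^ 2 := by
  have hre := norm_sum_oddRiesz_sub_le h0 h1
    (fun i => (Complex.abs_re_le_norm (b i)).trans (hb i)) hu
  have him := norm_sum_oddRiesz_sub_le h0 h1
    (fun i => (Complex.abs_im_le_norm (b i)).trans (hb i)) hu
  set x := (2 ^ Fintype.card ι : ℂ)⁻¹ ^ 2 *
    ∑ ε, ∑ ε', (oddRiesz η (fun i => (b i).re) ε ε' : ℂ) * (u ε * u ε') with hx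
  set y := (2 ^ Fintype.card ι : ℂ)⁻¹ ^ 2 *
    ∑ ε, ∑ ε', (oddRiesz η (fun i => (b i).im) ε ε' : ℂ) * (u ε * u ε') with hy
  have e1 : (2 ^ Fintype.card ι : ℂ)⁻¹ ^ 2 * ∑ ε, ∑ ε', rieszKernel η b ε ε' * (u ε * u ε') =
      x + Complex.I * y := by
    rw [hx, hy, mul_left_comm, ← mul_add]
    simp only [rieszKernel, add_mul, Finset.sum_add_distrib, mul_assoc, Finset.mul_sum]
  have e2 : ∑ i, b i * walshCoeff u {i} ^ 2 = ∑ i, ((b i).re : ℂ) * walshCoeff u {i} ^ 2 +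
      Complex.I * ∑ i, ((b i).im : ℂ) * walshCoeff u {i} ^ 2 := by
    rw [Finset.mul_sum, ← Finset.sum_add_distrib]
    refine Finset.sum_congr rfl fun i _ => ?_
    conv_lhs => rw [← Complex.re_add_im (b i)]
    ring
  rw [e1, e2, add_sub_add_comm, ← mul_sub]
  refine (norm_add_le _ _).trans ?_
  rw [norm_mul, Complex.norm_I, one_mul]
  linarith

/-- The first Walsh coefficients of a coordinate sign. -/
lemma walshCoeff_sgn (i j : ι) :
    walshCoeff (fun ε => (sgn (ε j) : ℂ)) {i} = if i = j then 1 else 0 := by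
  have hN : (2 ^ Fintype.card ι : ℂ) ≠ 0 := pow_ne_zero _ two_ne_zero
  rw [walshCoeff]
  split_ifs with h
  · subst h
    have : ∀ ε : ι → Bool, (walsh {i} ε : ℂ) * (sgn (ε i) : ℂ) = 1 := fun ε => by
      simp only [walsh, Finset.prod_singleton]
      cases ε i <;> simp
    simp [this]
  · rw [mul_eq_zero]
    right
    -- Flipping the j-th sign pairs terms of opposite value.
    refine Finset.sum_involution (fun ε _ => Function.update ε j (!ε j)) ?_ ?_ (by simp) (by simp)
    · intro ε _
      simp only [walsh, Finset.prod_singleton, Function.update_self, Function.update_of_ne h]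
      cases ε j <;> simp
    · intro ε _ _ heq
      have := congrFun heq j
      simp at this

end Riesz

/-! ### Interpolation by integrable functions -/

section Interpolation

variable {T : Type*} [MeasurableSpace T] {m : Measure T}

lemma ae_norm_le_norm (φ : Lp ℂ ∞ m) : ∀ᵐ t ∂m, ‖φ t‖ ≤ ‖φ‖ := by
  filter_upwards [ae_le_eLpNormEssSup (f := (φ : T → ℂ)) (μ := m)] with t ht
  rw [Lp.norm_def, eLpNorm_exponent_top, ← toReal_enorm]
  refine ENNReal.toReal_mono ?_ ht
  rw [← eLpNorm_exponent_top]
  exact Lp.eLpNorm_ne_top φ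

/-- The `L_∞` norm is almost attained by pairing with the unit ball of `L_1`. -/
lemma exists_integrable_lt_re_integral [IsProbabilityMeasure m] (h : Lp ℂ ∞ m) {r : ℝ}
    (h0 : 0 < r) (hr : r < ‖h‖) :
    ∃ f : T → ℂ, Integrable f m ∧ ∫ t, ‖f t‖ ∂m ≤ 1 ∧ r ≤ (∫ t, f t * h t ∂m).re := by
  have hm : StronglyMeasurable (h : T → ℂ) := Lp.stronglyMeasurable h
  set E : Set T := {t | r < ‖h t‖} with hE
  have hEm : MeasurableSet E := measurableSet_lt measurable_const hm.norm.measurable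
  have hE0 : 0 < m.real E := by
    refine (measureReal_nonneg).lt_of_ne' fun h' => hr.not_ge ?_
    have hae : ∀ᵐ t ∂m, ‖h t‖ ≤ r := by
      have h'' : m E = 0 := (measureReal_eq_zero_iff).1 h'
      filter_upwards [measure_eq_zero_iff_ae_notMem.1 h''] with t ht
      exact not_lt.1 ht
    simpa using Lp.norm_le_of_ae_bound h0.le hae
  -- Normalized indicator of {‖h‖ > r} times the conjugate phase of h, so that f h = ‖h‖ / m(E) on
  -- E.
  set f : T → ℂ := E.indicator fun t => ((m.real E)⁻¹ : ℂ) * (conj (h t) / (‖h t‖ : ℂ)) with hf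
  have hfm : AEStronglyMeasurable f m := by
    refine (StronglyMeasurable.indicator ?_ hEm).aestronglyMeasurable
    have h1 : Measurable (h : T → ℂ) := hm.measurable
    have h2 : Measurable fun t => conj (h t) := Complex.continuous_conj.measurable.comp h1
    have h3 : Measurable fun t => (‖h t‖ : ℂ) := Complex.measurable_ofReal.comp h1.norm
    exact ((h2.div h3).const_mul _).stronglyMeasurable
  have hfn : ∀ t, ‖f t‖ = E.indicator (fun _ => (m.real E)⁻¹) t := by
    intro t
    by_cases ht : t ∈ E
    · have : ‖h t‖ ≠ 0 := (h0.trans ht).ne'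
      simp [hf, ht, this, abs_of_pos hE0]
    · simp [hf, ht]
  have hc : Integrable (E.indicator fun _ => (m.real E)⁻¹ : T → ℝ) m :=
    (integrable_const _).indicator hEm
  have hfi : Integrable f m := by
    refine (integrable_norm_iff hfm).1 (hc.congr (.of_forall fun t => (hfn t).symm))
  have hfh : ∀ t, f t * h t = ((E.indicator (fun t => (m.real E)⁻¹ * ‖h t‖) t : ℝ) : ℂ) := by
    intro t
    by_cases ht : t ∈ E
    · have : (‖h t‖ : ℂ) ≠ 0 := by exact_mod_cast (h0.trans ht).ne'
      simp only [hf, Set.indicator_of_mem ht]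
      rw [mul_assoc, div_mul_eq_mul_div, Complex.conj_mul', sq, mul_div_assoc, div_self this]
      push_cast
      ring
    · simp [hf, ht]
  refine ⟨f, hfi, ?_, ?_⟩
  · simp only [hfn]
    rw [integral_indicator_const _ hEm, smul_eq_mul, mul_inv_cancel₀ hE0.ne']
  · simp only [hfh]
    rw [integral_complex_ofReal, Complex.ofReal_re]
    have hi : Integrable (fun t => E.indicator (fun t => (m.real E)⁻¹ * ‖h t‖) t) m := by
      refine Integrable.indicator (Integrable.const_mul ?_ _) hEm
      exact Integrable.of_bound hm.norm.aestronglyMeasurable ‖h‖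
        ((ae_norm_le_norm h).mono fun t ht => by simpa using ht)
    calc r = ∫ t, E.indicator (fun _ => (m.real E)⁻¹ * r) t ∂m := by
          rw [integral_indicator_const _ hEm, smul_eq_mul, mul_inv_cancel_left₀ hE0.ne']
      _ ≤ _ := by
          refine integral_mono ((integrable_const _).indicator hEm) hi fun t => ?_
          refine Set.indicator_le_indicator' fun ht => ?_
          have : r < ‖h t‖ := ht
          gcongr

/-- The pairing of `L_1` with `L_∞`. -/
def pairing (φ : Lp ℂ ∞ m) : Lp ℂ 1 m →L[ℂ] ℂ :=
  ((ContinuousLinearMap.mul ℂ ℂ).lpPairing m 1 ∞).flip φ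

lemma pairing_apply (φ : Lp ℂ ∞ m) (f : Lp ℂ 1 m) : pairing φ f = ∫ t, f t * φ t ∂m := by
  rw [pairing, ContinuousLinearMap.flip_apply, ContinuousLinearMap.lpPairing_eq_integral]
  rfl

lemma exists_norm_le_one_le_re_pairing [IsProbabilityMeasure m] (h : Lp ℂ ∞ m) {r : ℝ}
    (h0 : 0 < r) (hr : r < ‖h‖) : ∃ f : Lp ℂ 1 m, ‖f‖ ≤ 1 ∧ r ≤ (pairing h f).re := by
  obtain ⟨f, hf, h1, h2⟩ := exists_integrable_lt_re_integral h h0 hr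
  refine ⟨hf.toL1 f, ?_, ?_⟩
  · rw [L1.norm_eq_integral_norm]
    refine le_trans (le_of_eq (integral_congr_ae ?_)) h1
    filter_upwards [hf.coeFn_toL1] with t ht
    rw [ht]
  · rw [pairing_apply]
    refine h2.trans_eq (congrArg Complex.re (integral_congr_ae ?_))
    filter_upwards [hf.coeFn_toL1] with t ht
    rw [ht]

lemma pairing_sum_smul {ι : Type*} (s : Finset ι) (x : ι → ℂ) (φ : ι → Lp ℂ ∞ m)
    (f : Lp ℂ 1 m) : pairing (∑ i ∈ s, x i • φ i) f = ∑ i ∈ s, x i * pairing (φ i) f := by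
  simp only [pairing, map_sum, map_smul, sum_apply,
    smul_apply, smul_eq_mul]

/-- If `(φ i)` is a finite Sidon family with constant `C`, every `z` in the unit ball of `ℓ_∞` is
interpolated on `(φ i)` by a function of `L_1` norm less than `C + 1`. -/
lemma exists_pairing_eq [IsProbabilityMeasure m] {ι : Type*} [Fintype ι] (φ : ι → Lp ℂ ∞ m)
    {C : ℝ} (hC : 0 ≤ C) (hφ : ∀ x : ι → ℂ, ∑ i, ‖x i‖ ≤ C * ‖∑ i, x i • φ i‖)
    (z : ι → ℂ) (hz : ∀ i, ‖z i‖ ≤ 1) :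
    ∃ f : Lp ℂ 1 m, ‖f‖ < C + 1 ∧ ∀ i, pairing (φ i) f = z i := by
  classical
  let A : Lp ℂ 1 m →L[ℂ] (ι → ℂ) := ContinuousLinearMap.pi fun i => pairing (φ i)
  have hzero : ∀ x : ι → ℂ, ‖∑ i, x i • φ i‖ ≤ 0 → x = 0 := by
    intro x hx
    have h1 : ∑ i, ‖x i‖ ≤ 0 := (hφ x).trans (mul_nonpos_of_nonneg_of_nonpos hC hx)
    have h2 := (Finset.sum_eq_zero_iff_of_nonneg fun i _ => norm_nonneg (x i)).1
      (h1.antisymm (Finset.sum_nonneg fun i _ => norm_nonneg _))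
    exact funext fun i => norm_eq_zero.1 (h2 i (Finset.mem_univ i))
  have hlin : ∀ (g : (ι → ℂ) →ₗ[ℂ] ℂ) (v : ι → ℂ), g v = ∑ i, v i * g (Pi.single i 1) := by
    intro g v
    rw [LinearMap.pi_apply_eq_sum_univ g v]
    refine Finset.sum_congr rfl fun i _ => ?_
    rw [smul_eq_mul]
    congr 2
    funext j
    simp [Pi.single_apply, eq_comm]
  have hfun : ∀ (g : (ι → ℂ) →ₗ[ℂ] ℂ) (f : Lp ℂ 1 m),
      g (A f) = pairing (∑ i, g (Pi.single i 1) • φ i) f := by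
    intro g f
    rw [pairing_sum_smul, hlin g (A f)]
    exact Finset.sum_congr rfl fun i _ => mul_comm _ _
  -- A functional vanishing on the range would give a combination of the φ_i with zero norm, hence
  -- zero coefficients. Surjectivity makes the image of a ball open, which Hahn–Banach needs below.
  have hsurj : Function.Surjective A := by
    by_contra hns
    have hlt : LinearMap.range A.toLinearMap < ⊤ :=
      lt_top_iff_ne_top.2 fun h => hns (LinearMap.range_eq_top.1 h)
    obtain ⟨g, hg0, hg⟩ := Submodule.exists_le_ker_of_lt_top _ hlt
    refine hg0 ?_
    have hx : (fun i => g (Pi.single i 1)) = 0 := by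
      refine hzero _ (not_lt.1 fun hpos => ?_)
      obtain ⟨f, -, hf⟩ := exists_norm_le_one_le_re_pairing _ (half_pos hpos) (half_lt_self hpos)
      rw [← hfun, (hg ⟨f, rfl⟩ : g (A f) = 0), Complex.zero_re] at hf
      linarith
    refine LinearMap.pi_ext' fun i => LinearMap.ext_ring ?_
    simpa using congrFun hx i
  by_contra! hcon
  have hopen : IsOpen (A '' Metric.ball 0 (C + 1)) := A.isOpenMap hsurj _ Metric.isOpen_ball
  have hconv : Convex ℝ (A '' Metric.ball 0 (C + 1)) :=
    (convex_ball _ _).linear_image (A.toLinearMap.restrictScalars ℝ)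
  have hnot : z ∉ A '' Metric.ball 0 (C + 1) := by
    rintro ⟨f, hf, hfz⟩
    obtain ⟨i, hi⟩ := hcon f (by simpa using hf)
    exact hi (congrFun hfz i)
  obtain ⟨g, hg⟩ := RCLike.geometric_hahn_banach_open_point (𝕜 := ℂ) hconv hopen hnot
  set x : ι → ℂ := fun i => g (Pi.single i 1) with hx
  set h : Lp ℂ ∞ m := ∑ i, x i • φ i with hh
  have hgA : ∀ f, g (A f) = pairing h f := fun f => hfun g.toLinearMap f
  have hgz : (g z).re ≤ C * ‖h‖ := by
    have e : g z = ∑ i, z i * x i := hlin g.toLinearMap z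
    calc (g z).re ≤ ‖g z‖ := Complex.re_le_norm _
      _ ≤ ∑ i, ‖x i‖ := by
          rw [e]
          refine norm_sum_le_of_le _ fun i _ => ?_
          rw [norm_mul]
          exact mul_le_of_le_one_left (norm_nonneg _) (hz i)
      _ ≤ C * ‖h‖ := hφ x
  have hpos : 0 < (g z).re := by
    have := hg (A 0) ⟨0, by simpa using by linarith, rfl⟩
    simpa using this
  have hhpos : 0 < ‖h‖ := by
    refine (norm_nonneg _).lt_of_ne' fun h0 => ?_
    rw [h0, mul_zero] at hgz
    linarith
  have hden : 0 < C + 1 / 2 := by linarith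
  -- The gap between C and C + 1 is used here: (C + 1/2) f lies in the open ball and pairs with h to
  -- at least (C + 1/4) ‖h‖ > C ‖h‖ ≥ Re g(z), against the separation.
  obtain ⟨f, hf1, hf2⟩ := exists_norm_le_one_le_re_pairing h
    (r := ‖h‖ * ((C + 1 / 4) / (C + 1 / 2))) (by positivity)
    (mul_lt_of_lt_one_right hhpos ((div_lt_one hden).2 (by linarith)))
  have : (g (A (((C + 1 / 2 : ℝ) : ℂ) • f))).re < (g z).re := hg _ ⟨_, ?_, rfl⟩
  · rw [map_smul, map_smul, hgA, smul_eq_mul, Complex.re_ofReal_mul] at this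
    have h3 : (C + 1 / 2) * (‖h‖ * ((C + 1 / 4) / (C + 1 / 2))) ≤
      (C + 1 / 2) * (pairing h f).re := by gcongr
    have h4 : (C + 1 / 2) * (‖h‖ * ((C + 1 / 4) / (C + 1 / 2))) = ‖h‖ * (C + 1 / 4) := by
      field_simp
    nlinarith
  · rw [mem_ball_zero_iff, norm_smul, Complex.norm_real, Real.norm_eq_abs, abs_of_pos hden]
    nlinarith [norm_nonneg f]

end Interpolation

/-! ### Riesz kernels with coefficients depending on a parameter -/

section Kernel

variable {ι : Type*} [Fintype ι] [DecidableEq ι] {X : Type*} [MeasurableSpace X] {ν : Measure X}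
  {β : X → ι → ℂ} {η : ℝ}

/-- Crude and dependent on the cardinality; it serves only integrability and never enters the final
constant. -/
lemma norm_rieszKernel_le (h0 : 0 < η) (h1 : η ≤ 1) {b : ι → ℂ} (hb : ∀ i, ‖b i‖ ≤ 1)
    (ε ε' : ι → Bool) : ‖rieszKernel η b ε ε'‖ ≤ (2 ^ Fintype.card ι) ^ 2 * (2 * η⁻¹) :=
  calc ‖rieszKernel η b ε ε'‖ ≤ ∑ ε', ‖rieszKernel η b ε ε'‖ :=
        Finset.single_le_sum (f := fun ε' => ‖rieszKernel η b ε ε'‖)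
          (fun _ _ => norm_nonneg _) (Finset.mem_univ ε')
    _ ≤ ∑ ε, ∑ ε', ‖rieszKernel η b ε ε'‖ :=
        Finset.single_le_sum (f := fun ε => ∑ ε', ‖rieszKernel η b ε ε'‖)
          (fun _ _ => Finset.sum_nonneg fun _ _ => norm_nonneg _) (Finset.mem_univ ε)
    _ ≤ _ := sum_norm_rieszKernel_le h0 h1 hb

omit [DecidableEq ι] in
lemma aestronglyMeasurable_rieszKernel (hβ : Measurable β) (ε ε' : ι → Bool) :
    AEStronglyMeasurable (fun p => rieszKernel η (β p) ε ε') ν :=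
  ((continuous_rieszKernel η ε ε').measurable.comp hβ).aestronglyMeasurable

lemma integrable_rieszKernel [IsFiniteMeasure ν] (h0 : 0 < η) (h1 : η ≤ 1) (hβ : Measurable β)
    (hβ1 : ∀ᵐ p ∂ν, ∀ i, ‖β p i‖ ≤ 1) (ε ε' : ι → Bool) :
    Integrable (fun p => rieszKernel η (β p) ε ε') ν :=
  Integrable.of_bound (aestronglyMeasurable_rieszKernel hβ ε ε') _
    (hβ1.mono fun _ hp => norm_rieszKernel_le h0 h1 hp ε ε')

/-- The functional attached to a Riesz kernel almost diagonalizes `u ⊗ u`. -/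
lemma norm_sum_integral_rieszKernel_sub_le [IsProbabilityMeasure ν] (h0 : 0 < η) (h1 : η ≤ 1)
    (hβ : Measurable β) (hβ1 : ∀ᵐ p ∂ν, ∀ i, ‖β p i‖ ≤ 1) {w : X → ℂ} {W : ℝ}
    (hw : AEStronglyMeasurable w ν) (hwW : ∀ᵐ p ∂ν, ‖w p‖ ≤ W)
    {u : (ι → Bool) → ℂ} {B : ℝ} (hu : ∀ ε, ‖u ε‖ ≤ B) :
    ‖(2 ^ Fintype.card ι : ℂ)⁻¹ ^ 2 *
        ∑ ε, ∑ ε', (∫ p, rieszKernel η (β p) ε ε' * w p ∂ν) * (u ε * u ε') -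
      ∑ i, (∫ p, β p i * w p ∂ν) * walshCoeff u {i} ^ 2‖ ≤ 2 * η ^ 2 * B ^ 2 * W := by
  have hwi : Integrable w ν := Integrable.of_bound hw W hwW
  have hQ : ∀ ε ε', Integrable (fun p => rieszKernel η (β p) ε ε' * w p) ν := fun ε ε' =>
    hwi.bdd_mul (aestronglyMeasurable_rieszKernel hβ ε ε')
      (hβ1.mono fun _ hp => norm_rieszKernel_le h0 h1 hp ε ε')
  have hB : ∀ i, Integrable (fun p => β p i * w p) ν := fun i =>
    hwi.bdd_mul (c := 1) ((measurable_pi_apply i).comp hβ).aestronglyMeasurable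
      (hβ1.mono fun _ hp => hp i)
  have e1 : (2 ^ Fintype.card ι : ℂ)⁻¹ ^ 2 *
      ∑ ε, ∑ ε', (∫ p, rieszKernel η (β p) ε ε' * w p ∂ν) * (u ε * u ε') =
      ∫ p, (2 ^ Fintype.card ι : ℂ)⁻¹ ^ 2 *
        ∑ ε, ∑ ε', rieszKernel η (β p) ε ε' * w p * (u ε * u ε') ∂ν := by
    rw [integral_const_mul, integral_finsetSum]
    · congr 1
      refine Finset.sum_congr rfl fun ε _ => ?_
      rw [integral_finsetSum]
      · simp only [integral_mul_const]
      · exact fun ε' _ => (hQ ε ε').mul_const _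
    · exact fun ε _ => integrable_finsetSum _ fun ε' _ => (hQ ε ε').mul_const _
  have e2 : ∑ i, (∫ p, β p i * w p ∂ν) * walshCoeff u {i} ^ 2 =
      ∫ p, ∑ i, β p i * w p * walshCoeff u {i} ^ 2 ∂ν := by
    rw [integral_finsetSum]
    · simp only [integral_mul_const]
    · exact fun i _ => (hB i).mul_const _
  rw [e1, e2, ← integral_sub]
  · refine (norm_integral_le_of_norm_le_const (C := 2 * η ^ 2 * B ^ 2 * W) ?_).trans_eq (by simp)
    filter_upwards [hβ1, hwW] with p hp hpw
    have e3 : (2 ^ Fintype.card ι : ℂ)⁻¹ ^ 2 *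
        ∑ ε, ∑ ε', rieszKernel η (β p) ε ε' * w p * (u ε * u ε') -
        ∑ i, β p i * w p * walshCoeff u {i} ^ 2 =
        ((2 ^ Fintype.card ι : ℂ)⁻¹ ^ 2 *
          ∑ ε, ∑ ε', rieszKernel η (β p) ε ε' * (u ε * u ε') -
          ∑ i, β p i * walshCoeff u {i} ^ 2) * w p := by
      rw [sub_mul, mul_assoc, Finset.sum_mul, Finset.sum_mul]
      congr 1
      · congr 1
        refine Finset.sum_congr rfl fun ε _ => ?_
        rw [Finset.sum_mul]
        exact Finset.sum_congr rfl fun ε' _ => by ring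
      · exact Finset.sum_congr rfl fun i _ => by ring
    rw [e3, norm_mul]
    exact mul_le_mul (norm_sum_rieszKernel_sub_le h0 h1 hp hu) hpw (norm_nonneg _) (by positivity)
  · exact (integrable_finsetSum _ fun ε _ =>
      integrable_finsetSum _ fun ε' _ => (hQ ε ε').mul_const _).const_mul _
  · exact integrable_finsetSum _ fun i _ => (hB i).mul_const _

/-- The functional attached to a Riesz kernel is bounded on `L_∞`. -/
lemma norm_sum_integral_rieszKernel_mul_le [IsProbabilityMeasure ν] {Y : Type*}
    [MeasurableSpace Y] {μ : Measure Y} [SFinite μ] (h0 : 0 < η) (h1 : η ≤ 1)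
    (hβ : Measurable β) (hβ1 : ∀ᵐ p ∂ν, ∀ i, ‖β p i‖ ≤ 1)
    {F : (ι → Bool) → (ι → Bool) → Y → ℂ} (hF : ∀ ε ε', Integrable (F ε ε') μ) {K : ℝ}
    (hFK : ∀ ε ε', ∫ y, ‖F ε ε' y‖ ∂μ ≤ K) {S : Y × X → ℂ} {M : ℝ} (hM : 0 ≤ M)
    (hS : ∀ᵐ q ∂μ.prod ν, ‖S q‖ ≤ M) :
    ‖(2 ^ Fintype.card ι : ℂ)⁻¹ ^ 2 *
        ∑ ε, ∑ ε', ∫ q, F ε ε' q.1 * rieszKernel η (β q.2) ε ε' * S q ∂μ.prod ν‖ ≤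
      2 * η⁻¹ * K * M := by
  set N : ℝ := 2 ^ Fintype.card ι with hN
  have hN0 : 0 < N := by positivity
  have hK : 0 ≤ K := (integral_nonneg fun _ => norm_nonneg _).trans
    (hFK (fun _ => true) fun _ => true)
  have hterm : ∀ ε ε', ‖∫ q, F ε ε' q.1 * rieszKernel η (β q.2) ε ε' * S q ∂μ.prod ν‖ ≤
      K * M * ∫ p, ‖rieszKernel η (β p) ε ε'‖ ∂ν := by
    intro ε ε'
    have hQ := integrable_rieszKernel h0 h1 hβ hβ1 ε ε'
    calc _ ≤ ∫ q : Y × X, ‖F ε ε' q.1‖ * ‖rieszKernel η (β q.2) ε ε'‖ * M ∂μ.prod ν := by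
          refine norm_integral_le_of_norm_le (((hF ε ε').norm.mul_prod hQ.norm).mul_const M) ?_
          filter_upwards [hS] with q hq
          rw [norm_mul, norm_mul]
          gcongr
      _ = (∫ y, ‖F ε ε' y‖ ∂μ) * (∫ p, ‖rieszKernel η (β p) ε ε'‖ ∂ν) * M := by
          rw [integral_mul_const, integral_prod_mul (fun y => ‖F ε ε' y‖)
            (fun p => ‖rieszKernel η (β p) ε ε'‖)]
      _ ≤ K * (∫ p, ‖rieszKernel η (β p) ε ε'‖ ∂ν) * M := by
          gcongr
          exact hFK ε ε'
      _ = _ := by ring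
  -- Summing over signs before integrating uses the mass bound at each p; its factor N² cancels the
  -- normalization, so the result does not depend on the cardinality of ι.
  have hsum : ∑ ε, ∑ ε', ∫ p, ‖rieszKernel η (β p) ε ε'‖ ∂ν ≤ N ^ 2 * (2 * η⁻¹) := by
    have hQ := fun ε ε' => (integrable_rieszKernel h0 h1 hβ hβ1 ε ε').norm
    have e : ∑ ε, ∑ ε', ∫ p, ‖rieszKernel η (β p) ε ε'‖ ∂ν =
        ∫ p, ∑ ε, ∑ ε', ‖rieszKernel η (β p) ε ε'‖ ∂ν := by
      rw [integral_finsetSum _ fun ε _ => integrable_finsetSum _ fun ε' _ => hQ ε ε']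
      exact Finset.sum_congr rfl fun ε _ => (integral_finsetSum _ fun ε' _ => hQ ε ε').symm
    rw [e]
    refine (integral_mono_ae (integrable_finsetSum _ fun ε _ =>
      integrable_finsetSum _ fun ε' _ => hQ ε ε') (integrable_const (N ^ 2 * (2 * η⁻¹)))
      (hβ1.mono fun p hp => sum_norm_rieszKernel_le h0 h1 hp)).trans_eq (by simp)
  have hn : ‖(2 ^ Fintype.card ι : ℂ)⁻¹ ^ 2‖ = N⁻¹ ^ 2 := by simp [hN]
  rw [norm_mul, hn]
  calc _ ≤ N⁻¹ ^ 2 * ∑ ε, ∑ ε', K * M * ∫ p, ‖rieszKernel η (β p) ε ε'‖ ∂ν := by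
        gcongr
        exact norm_sum_le_of_le _ fun ε _ => norm_sum_le_of_le _ fun ε' _ => hterm ε ε'
    _ = N⁻¹ ^ 2 * (K * M * ∑ ε, ∑ ε', ∫ p, ‖rieszKernel η (β p) ε ε'‖ ∂ν) := by
        simp only [Finset.mul_sum]
    _ ≤ N⁻¹ ^ 2 * (K * M * (N ^ 2 * (2 * η⁻¹))) := by gcongr
    _ = 2 * η⁻¹ * K * M := by field_simp

end Kernel

/-! ### Fourfold products -/

section Fourfold

variable {T : Type*} [MeasurableSpace T] {m : Measure T} [IsProbabilityMeasure m]

/-- Groups the four variables in pairs: the first pair meets the interpolating functions, the second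
is the parameter of the Riesz kernel. -/
lemma measurePreserving_vecCons_four :
    MeasurePreserving (fun p : (T × T) × (T × T) => ![p.1.1, p.1.2, p.2.1, p.2.2])
      ((m.prod m).prod (m.prod m)) (Measure.pi fun _ : Fin 4 => m) := by
  have hmeas : Measurable fun p : (T × T) × (T × T) => ![p.1.1, p.1.2, p.2.1, p.2.2] := by
    refine measurable_pi_lambda _ fun i => ?_
    fin_cases i
    · exact measurable_fst.fst
    · exact measurable_fst.snd
    · exact measurable_snd.fst
    · exact measurable_snd.snd
  refine ⟨hmeas, (Measure.pi_eq fun s hs => ?_).symm⟩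
  rw [Measure.map_apply hmeas (MeasurableSet.univ_pi hs)]
  have : (fun p : (T × T) × (T × T) => ![p.1.1, p.1.2, p.2.1, p.2.2]) ⁻¹' Set.pi Set.univ s =
      (s 0 ×ˢ s 1) ×ˢ (s 2 ×ˢ s 3) := by
    ext p
    simp [Fin.forall_fin_succ, and_assoc]
  rw [this, Measure.prod_prod, Measure.prod_prod, Measure.prod_prod, Fin.prod_univ_four]
  ring

lemma coeFn_finsetSum {X : Type*} [MeasurableSpace X] {ν : Measure X} {κ : Type*} (s : Finset κ)
    (g : κ → Lp ℂ ∞ ν) : ((∑ i ∈ s, g i : Lp ℂ ∞ ν) : X → ℂ) =ᵐ[ν] fun t => ∑ i ∈ s, g i t := by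
  classical
  induction s using Finset.induction_on with
  | empty =>
    filter_upwards [Lp.coeFn_zero ℂ ∞ ν] with t ht
    simpa using ht
  | insert i s hi ih =>
    rw [Finset.sum_insert hi]
    filter_upwards [Lp.coeFn_add (g i) (∑ j ∈ s, g j), ih] with t h1 h2
    rw [h1, Pi.add_apply, h2, Finset.sum_insert hi]

lemma ae_norm_sum_le_norm_sum_tensorPow (s : Finset (Lp ℂ ∞ m)) (x : Lp ℂ ∞ m → ℂ) :
    ∀ᵐ p : (T × T) × (T × T) ∂(m.prod m).prod (m.prod m),
      ‖∑ φ ∈ s, x φ * (φ p.1.1 * φ p.1.2 * (φ p.2.1 * φ p.2.2))‖ ≤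
        ‖∑ φ ∈ s, x φ • tensorPow 4 φ‖ := by
  have h : ∀ᵐ t ∂(Measure.pi fun _ : Fin 4 => m),
      ‖∑ φ ∈ s, x φ * ∏ i, φ (t i)‖ ≤ ‖∑ φ ∈ s, x φ • tensorPow 4 φ‖ := by
    have hs : ∀ᵐ t ∂(Measure.pi fun _ : Fin 4 => m), ∀ φ ∈ s,
        (x φ • tensorPow 4 φ : Lp ℂ ∞ (Measure.pi fun _ : Fin 4 => m)) t =
          x φ * ∏ i, φ (t i) := by
      refine (ae_ball_iff s.countable_toSet).2 fun φ _ => ?_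
      filter_upwards [Lp.coeFn_smul (x φ) (tensorPow 4 φ),
        (memLp_tensorPowFun 4 φ).coeFn_toLp] with t h1 h2
      rw [h1, Pi.smul_apply, smul_eq_mul, tensorPow, h2, tensorPowFun]
    filter_upwards [ae_norm_le_norm (∑ φ ∈ s, x φ • tensorPow 4 φ),
      coeFn_finsetSum s fun φ => x φ • tensorPow 4 φ, hs] with t h1 h2 h3
    rwa [h2, Finset.sum_congr rfl h3] at h1
  filter_upwards [measurePreserving_vecCons_four.quasiMeasurePreserving.ae h] with p hp
  simpa [Fin.prod_univ_four, mul_assoc] using hp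

lemma sq_le_integral_mul_conj {δ : ℝ} (hδ : 0 < δ) {φ : Lp ℂ ∞ m}
    (h : δ ≤ (eLpNorm φ 2 m).toReal) :
    ∃ c : ℝ, δ ^ 2 ≤ c ∧ ∫ t, φ t * conj (φ t) ∂m = c := by
  refine ⟨∫ t, ‖φ t‖ ^ 2 ∂m, ?_, ?_⟩
  · have h2 : MemLp (φ : T → ℂ) 2 m := (Lp.memLp φ).mono_exponent le_top
    have hn : 0 ≤ ∫ t, ‖φ t‖ ^ 2 ∂m := integral_nonneg fun t => by positivity
    rw [h2.eLpNorm_eq_integral_rpow_norm two_ne_zero ENNReal.ofNat_ne_top] at h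
    simp only [ENNReal.toReal_ofNat, Real.rpow_two] at h
    rw [ENNReal.toReal_ofReal (by positivity)] at h
    calc δ ^ 2 ≤ ((∫ t, ‖φ t‖ ^ 2 ∂m) ^ (2⁻¹ : ℝ)) ^ 2 := by gcongr
      _ = ∫ t, ‖φ t‖ ^ 2 ∂m := by
          rw [← Real.rpow_natCast, ← Real.rpow_mul hn]
          norm_num
  · rw [← integral_complex_ofReal]
    refine integral_congr_ae (.of_forall fun t => ?_)
    simp [Complex.mul_conj']

end Fourfold

/-! ### The union of two mutually orthogonal Sidon sets -/

section Union

variable {T : Type*} [MeasurableSpace T] {m : Measure T}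

lemma norm_pairing_le [IsProbabilityMeasure m] {φ : Lp ℂ ∞ m} {D : ℝ} (hφ : ‖φ‖ ≤ D)
    {f : Lp ℂ 1 m} {K : ℝ} (hf : ‖f‖ ≤ K) : ‖pairing φ f‖ ≤ K * D := by
  have hfi : Integrable f m := L1.integrable_coeFn f
  rw [pairing_apply]
  calc ‖∫ t, f t * φ t ∂m‖ ≤ ∫ t, ‖f t‖ * ‖φ‖ ∂m := by
        refine norm_integral_le_of_norm_le (hfi.norm.mul_const _) ?_
        filter_upwards [ae_norm_le_norm φ] with t ht
        rw [norm_mul]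
        gcongr
    _ = ‖f‖ * ‖φ‖ := by rw [integral_mul_const, L1.norm_eq_integral_norm]
    _ ≤ K * D := mul_le_mul hf hφ (norm_nonneg _) ((norm_nonneg _).trans hf)

/-- `‖a‖` is a multiple of `a` by a number of modulus at most one. -/
lemma exists_norm_le_one_mul_eq_norm (a : ℂ) : ∃ z : ℂ, ‖z‖ ≤ 1 ∧ a * z = ‖a‖ := by
  rcases eq_or_ne a 0 with rfl | ha
  · exact ⟨0, by simp, by simp⟩
  · have : (‖a‖ : ℂ) ≠ 0 := by exact_mod_cast norm_ne_zero_iff.2 ha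
    refine ⟨conj a / ‖a‖, ?_, ?_⟩
    · simp [norm_ne_zero_iff.2 ha]
    · rw [← mul_div_assoc, Complex.mul_conj', sq, mul_div_assoc, div_self this, mul_one]

/-- A finite Sidon set `s₁` orthogonal to the rest of a bounded finite set `s`: the coefficients
of a fourfold tensor series on `s₁` are controlled up to a small multiple of all coefficients. -/
lemma sum_norm_le_norm_sum_tensorPow_add [IsProbabilityMeasure m] {s s₁ : Finset (Lp ℂ ∞ m)}
    (hs : s₁ ⊆ s) {C D δ η : ℝ} (hC : 0 ≤ C) (hD : 0 < D) (hδ : 0 < δ) (h0 : 0 < η) (h1 : η ≤ 1)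
    (hsidon : ∀ x : s₁ → ℂ, ∑ i, ‖x i‖ ≤ C * ‖∑ i, x i • (i : Lp ℂ ∞ m)‖)
    (hbound : ∀ φ ∈ s, ‖φ‖ ≤ D) (hlow : ∀ φ ∈ s₁, δ ≤ (eLpNorm φ 2 m).toReal)
    (horth : ∀ φ ∈ s₁, ∀ ψ ∈ s, ψ ∉ s₁ → ∫ t, ψ t * conj (φ t) ∂m = 0) (x : Lp ℂ ∞ m → ℂ) :
    δ ^ 4 / D ^ 2 * ∑ φ ∈ s₁, ‖x φ‖ ≤
      2 * η⁻¹ * (C + 1) ^ 2 * ‖∑ φ ∈ s, x φ • tensorPow 4 φ‖ +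
        2 * η ^ 2 * ((C + 1) * D) ^ 2 * D ^ 2 * ∑ φ ∈ s, ‖x φ‖ := by
  classical
  have hK : 0 ≤ C + 1 := by linarith
  have hD' : (D : ℂ) ≠ 0 := by exact_mod_cast hD.ne'
  choose f hfK hf using fun ε : s₁ → Bool => exists_pairing_eq (fun i : s₁ => (i : Lp ℂ ∞ m)) hC
    hsidon (fun i => (sgn (ε i) : ℂ)) fun i => by simp
  choose z hz1 hz using fun φ => exists_norm_le_one_mul_eq_norm (x φ)
  -- The conjugates produce ⟨φ, φ_i⟩² after pairing with φ ⊗ φ, `z i` corrects the phase of `x i`,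
  -- and D ^ 2 keeps the modulus at most one.
  set β : T × T → s₁ → ℂ := fun p i =>
    z i / D ^ 2 * (conj ((i : Lp ℂ ∞ m) p.1) * conj ((i : Lp ℂ ∞ m) p.2)) with hβdef
  have hmeas : ∀ φ : Lp ℂ ∞ m, Measurable φ := fun φ => (Lp.stronglyMeasurable φ).measurable
  have hβ : Measurable β := by
    refine measurable_pi_lambda _ fun i => Measurable.const_mul (Measurable.mul ?_ ?_) _
    · exact Complex.continuous_conj.measurable.comp ((hmeas i).comp measurable_fst)
    · exact Complex.continuous_conj.measurable.comp ((hmeas i).comp measurable_snd)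
  have hprod : ∀ φ ∈ s, ∀ᵐ p : T × T ∂m.prod m, ‖φ p.1‖ ≤ D ∧ ‖φ p.2‖ ≤ D := by
    intro φ hφ
    have h := (ae_norm_le_norm φ).mono fun t ht => ht.trans (hbound φ hφ)
    exact (Measure.quasiMeasurePreserving_fst.ae h).and (Measure.quasiMeasurePreserving_snd.ae h)
  have hβ1 : ∀ᵐ p ∂m.prod m, ∀ i, ‖β p i‖ ≤ 1 := by
    refine ae_all_iff.2 fun i => ?_
    filter_upwards [hprod i (hs i.2)] with p hp
    simp only [hβdef, norm_mul, norm_div, norm_pow, Complex.norm_real, RCLike.norm_conj,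
      Real.norm_eq_abs, abs_of_pos hD]
    calc _ ≤ 1 / D ^ 2 * (D * D) := by
          gcongr
          · exact hz1 i
          · exact hp.1
          · exact hp.2
      _ = 1 := by field_simp
  set w : Lp ℂ ∞ m → T × T → ℂ := fun φ p => φ p.1 * φ p.2 with hw
  have hwm : ∀ φ, AEStronglyMeasurable (w φ) (m.prod m) := fun φ =>
    (((hmeas φ).comp measurable_fst).mul ((hmeas φ).comp measurable_snd)).aestronglyMeasurable
  have hwD : ∀ φ ∈ s, ∀ᵐ p ∂m.prod m, ‖w φ p‖ ≤ D ^ 2 := by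
    intro φ hφ
    filter_upwards [hprod φ hφ] with p hp
    rw [hw, norm_mul, sq]
    exact mul_le_mul hp.1 hp.2 (norm_nonneg _) hD.le
  set F : (s₁ → Bool) → (s₁ → Bool) → T × T → ℂ := fun ε ε' y => f ε y.1 * f ε' y.2 with hF
  have hfi : ∀ ε, Integrable (f ε) m := fun ε => L1.integrable_coeFn _
  have hFi : ∀ ε ε', Integrable (F ε ε') (m.prod m) := fun ε ε' => (hfi ε).mul_prod (hfi ε')
  have hFK : ∀ ε ε', ∫ y, ‖F ε ε' y‖ ∂m.prod m ≤ (C + 1) ^ 2 := by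
    intro ε ε'
    simp only [hF, norm_mul]
    rw [integral_prod_mul (fun t => ‖f ε t‖) (fun t => ‖f ε' t‖), ← L1.norm_eq_integral_norm,
      ← L1.norm_eq_integral_norm, sq]
    exact mul_le_mul (hfK ε).le (hfK ε').le (norm_nonneg _) hK
  set Q : (s₁ → Bool) → (s₁ → Bool) → T × T → ℂ := fun ε ε' p => rieszKernel η (β p) ε ε' with hQ
  have hQi : ∀ ε ε', Integrable (Q ε ε') (m.prod m) := integrable_rieszKernel h0 h1 hβ hβ1
  have hQw : ∀ φ ∈ s, ∀ ε ε', Integrable (fun p => Q ε ε' p * w φ p) (m.prod m) :=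
    fun φ hφ ε ε' => (hQi ε ε').mul_bdd (hwm φ) (hwD φ hφ)
  have hFw : ∀ φ ∈ s, ∀ ε ε', Integrable (fun y => F ε ε' y * w φ y) (m.prod m) :=
    fun φ hφ ε ε' => (hFi ε ε').mul_bdd (hwm φ) (hwD φ hφ)
  set u : Lp ℂ ∞ m → (s₁ → Bool) → ℂ := fun φ ε => pairing φ (f ε) with hu
  have huB : ∀ φ ∈ s, ∀ ε, ‖u φ ε‖ ≤ (C + 1) * D := fun φ hφ ε =>
    norm_pairing_le (hbound φ hφ) (hfK ε).le
  have hFu : ∀ φ ε ε', ∫ y, F ε ε' y * w φ y ∂m.prod m = u φ ε * u φ ε' := by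
    intro φ ε ε'
    simp only [hu, pairing_apply]
    rw [← integral_prod_mul]
    exact integral_congr_ae (.of_forall fun y => by simp only [hF, hw]; ring)
  set N : ℂ := (2 ^ Fintype.card s₁ : ℂ)⁻¹ ^ 2 with hN
  -- `V φ` is the value of the test functional on φ⊗φ⊗φ⊗φ; `G φ`, below, is its part of Walsh degree
  -- one.
  set V : Lp ℂ ∞ m → ℂ := fun φ =>
    N * ∑ ε, ∑ ε', (∫ p, Q ε ε' p * w φ p ∂m.prod m) * (u φ ε * u φ ε') with hV
  set G : Lp ℂ ∞ m → ℂ := fun φ =>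
    ∑ i, (∫ p, β p i * w φ p ∂m.prod m) * walshCoeff (u φ) {i} ^ 2 with hG
  have hVG : ∀ φ ∈ s, ‖V φ - G φ‖ ≤ 2 * η ^ 2 * ((C + 1) * D) ^ 2 * D ^ 2 := fun φ hφ =>
    norm_sum_integral_rieszKernel_sub_le h0 h1 hβ hβ1 (hwm φ) (hwD φ hφ) (huB φ hφ)
  have hupper : ‖∑ φ ∈ s, x φ * V φ‖ ≤
      2 * η⁻¹ * (C + 1) ^ 2 * ‖∑ φ ∈ s, x φ • tensorPow 4 φ‖ := by
    have h := norm_sum_integral_rieszKernel_mul_le h0 h1 hβ hβ1 hFi hFK (norm_nonneg _)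
      (ae_norm_sum_le_norm_sum_tensorPow s x)
    refine le_of_eq_of_le (congrArg norm ?_) h
    have hint : ∀ ε ε', ∫ q : (T × T) × (T × T), F ε ε' q.1 * rieszKernel η (β q.2) ε ε' *
          (∑ φ ∈ s, x φ * (φ q.1.1 * φ q.1.2 * (φ q.2.1 * φ q.2.2))) ∂(m.prod m).prod (m.prod m) =
        ∑ φ ∈ s, x φ * ((∫ p, Q ε ε' p * w φ p ∂m.prod m) * (u φ ε * u φ ε')) := by
      intro ε ε'
      have e : ∀ q : (T × T) × (T × T), F ε ε' q.1 * rieszKernel η (β q.2) ε ε' *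
          (∑ φ ∈ s, x φ * (φ q.1.1 * φ q.1.2 * (φ q.2.1 * φ q.2.2))) =
          ∑ φ ∈ s, x φ * ((F ε ε' q.1 * w φ q.1) * (Q ε ε' q.2 * w φ q.2)) := by
        intro q
        rw [Finset.mul_sum]
        exact Finset.sum_congr rfl fun φ _ => by simp only [hw, hQ]; ring
      simp only [e]
      rw [integral_finsetSum _ fun φ hφ =>
        ((hFw φ hφ ε ε').mul_prod (hQw φ hφ ε ε')).const_mul (x φ)]
      refine Finset.sum_congr rfl fun φ _ => ?_
      rw [integral_const_mul, integral_prod_mul (fun y => F ε ε' y * w φ y)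
        (fun p => Q ε ε' p * w φ p), hFu, mul_comm (u φ ε * u φ ε')]
    simp only [hint, hV]
    simp only [Finset.mul_sum]
    rw [Finset.sum_comm]
    refine Finset.sum_congr rfl fun ε _ => ?_
    rw [Finset.sum_comm]
    exact Finset.sum_congr rfl fun ε' _ => Finset.sum_congr rfl fun φ _ => by ring
  have hβw : ∀ φ (i : s₁), ∫ p, β p i * w φ p ∂m.prod m =
      z i / D ^ 2 * (∫ t, φ t * conj ((i : Lp ℂ ∞ m) t) ∂m) ^ 2 := by
    intro φ i
    rw [sq (∫ t, _ ∂m), ← integral_prod_mul, ← integral_const_mul]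
    exact integral_congr_ae (.of_forall fun p => by simp only [hβdef, hw]; ring)
  -- Off `s₁` the Walsh coefficients are unknown, but every ⟨φ, φ_i⟩ vanishes.
  have hG0 : ∀ φ ∈ s, φ ∉ s₁ → x φ * G φ = 0 := by
    intro φ hφ hφ'
    simp only [hG]
    rw [Finset.sum_eq_zero, mul_zero]
    intro i _
    rw [hβw, horth i i.2 φ hφ hφ']
    simp
  -- On `s₁` the roles are exchanged: ⟨φ, φ_i⟩ is uncontrolled for i ≠ φ, but the Walsh coefficient
  -- of `u φ` at {i} is then zero.
  have hG1 : ∀ φ ∈ s₁, ∃ c : ℝ, δ ^ 4 / D ^ 2 * ‖x φ‖ ≤ c ∧ x φ * G φ = c := by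
    intro φ hφ
    obtain ⟨c, hc, hint⟩ := sq_le_integral_mul_conj hδ (hlow φ hφ)
    refine ⟨c ^ 2 / D ^ 2 * ‖x φ‖, ?_, ?_⟩
    · gcongr
      calc δ ^ 4 = (δ ^ 2) ^ 2 := by ring
        _ ≤ c ^ 2 := by gcongr
    · have hux : u φ = fun ε => (sgn (ε ⟨φ, hφ⟩) : ℂ) := funext fun ε => hf ε ⟨φ, hφ⟩
      have : G φ = z φ / D ^ 2 * c ^ 2 := by
        simp only [hG, hux, walshCoeff_sgn]
        rw [Finset.sum_eq_single ⟨φ, hφ⟩ (fun i _ hi => by simp [hi]) (by simp), hβw, hint]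
        simp
      rw [this]
      push_cast
      rw [← hz φ]
      ring
  choose! c hc hGc using hG1
  have hmain : ∑ φ ∈ s, x φ * G φ = ((∑ φ ∈ s₁, c φ : ℝ) : ℂ) := by
    rw [← Finset.sum_subset hs hG0, Finset.sum_congr rfl hGc, Complex.ofReal_sum]
  calc δ ^ 4 / D ^ 2 * ∑ φ ∈ s₁, ‖x φ‖ ≤ ∑ φ ∈ s₁, c φ := by
        rw [Finset.mul_sum]
        exact Finset.sum_le_sum hc
    _ ≤ ‖∑ φ ∈ s, x φ * G φ‖ := by
        rw [hmain, Complex.norm_real]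
        exact le_abs_self _
    _ = ‖∑ φ ∈ s, x φ * V φ - ∑ φ ∈ s, x φ * (V φ - G φ)‖ := by
        rw [← Finset.sum_sub_distrib]
        congr 1
        exact Finset.sum_congr rfl fun φ _ => by ring
    _ ≤ ‖∑ φ ∈ s, x φ * V φ‖ + ‖∑ φ ∈ s, x φ * (V φ - G φ)‖ := norm_sub_le _ _
    _ ≤ _ := by
        refine add_le_add hupper ?_
        rw [Finset.mul_sum]
        refine norm_sum_le_of_le _ fun φ hφ => ?_
        rw [norm_mul, mul_comm]
        gcongr
        exact hVG φ hφ

/-! ### Restriction to finite subsets, and symmetry of orthogonality. -/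

lemma IsSidonFamily.sum_norm_le {ι : Type*} {f : ι → Lp ℂ ∞ m} {C : ℝ} (h : IsSidonFamily f C)
    (s : Finset ι) (x : ι → ℂ) : ∑ i ∈ s, ‖x i‖ ≤ C * ‖∑ i ∈ s, x i • f i‖ := by
  classical
  set y : ι →₀ ℂ := Finsupp.onFinset s (fun i => if i ∈ s then x i else 0)
    (fun i hi => by by_contra h'; simp [h'] at hi) with hy
  have hsub : y.support ⊆ s := Finsupp.support_onFinset_subset
  have hyx : ∀ i ∈ s, y i = x i := fun i hi => by simp [hy, hi]
  have h1 : ∑ i ∈ y.support, ‖y i‖ = ∑ i ∈ s, ‖x i‖ := by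
    rw [Finset.sum_subset hsub fun i _ hi => by simp [Finsupp.notMem_support_iff.1 hi]]
    exact Finset.sum_congr rfl fun i hi => by rw [hyx i hi]
  have h2 : ∑ i ∈ y.support, y i • f i = ∑ i ∈ s, x i • f i := by
    rw [Finset.sum_subset hsub fun i _ hi => by simp [Finsupp.notMem_support_iff.1 hi]]
    exact Finset.sum_congr rfl fun i hi => by rw [hyx i hi]
  rw [← h1, ← h2]
  exact h y

/-- The Sidon inequality for a finite subset of a Sidon set. -/
lemma IsSidonSet.sum_norm_le {S : Set (Lp ℂ ∞ m)} {C C' : ℝ} (h : IsSidonSet S C) (hC : C ≤ C')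
    {s : Finset (Lp ℂ ∞ m)} (hs : ∀ φ ∈ s, φ ∈ S) (x : s → ℂ) :
    ∑ i, ‖x i‖ ≤ C' * ‖∑ i, x i • (i : Lp ℂ ∞ m)‖ := by
  classical
  set y : Lp ℂ ∞ m → ℂ := fun φ => if hφ : φ ∈ s then x ⟨φ, hφ⟩ else 0 with hy
  have hyx : ∀ i : s, y i = x i := fun i => by simp [hy]
  have h1 := h.2.sum_norm_le (s.subtype (· ∈ S)) fun φ => y φ
  rw [Finset.sum_subtype_of_mem (fun φ => ‖y φ‖) hs,
    Finset.sum_subtype_of_mem (fun φ => y φ • φ) hs,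
    ← Finset.sum_coe_sort s fun φ => ‖y φ‖, ← Finset.sum_coe_sort s fun φ => y φ • φ] at h1
  simp only [hyx] at h1
  exact h1.trans (mul_le_mul_of_nonneg_right hC (norm_nonneg _))

lemma MutuallyOrthogonal.symm {S S' : Set (Lp ℂ ∞ m)} (h : MutuallyOrthogonal S S') :
    MutuallyOrthogonal S' S := by
  intro ψ hψ φ hφ
  have := congrArg conj (h φ hφ ψ hψ)
  rw [← integral_conj, map_zero] at this
  rw [← this]
  exact integral_congr_ae (.of_forall fun t => by simp [mul_comm])

end Union

end SidonSystem

end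

/-! ### Choice of constants and absorption of the error. -/

theorem mainTheorem4 (C₁ C₂ C₁' C₂' δ : ℝ) (hC₁' : 0 < C₁') (hC₂' : 0 < C₂') (hδ : 0 < δ) :
    ∃ C : ℝ, ∀ (T : Type*) [MeasurableSpace T] (m : Measure T) [IsProbabilityMeasure m]
      (Λ₁ Λ₂ : Set (Lp ℂ ∞ m)),
      SidonSystem.IsSidonSet Λ₁ C₁ →
      SidonSystem.IsSidonSet Λ₂ C₂ →
      SidonSystem.MutuallyOrthogonal Λ₁ Λ₂ →
      (∀ φ ∈ Λ₁, δ ≤ (eLpNorm φ 2 m).toReal ∧ ‖φ‖ ≤ C₁') →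
      (∀ φ ∈ Λ₂, δ ≤ (eLpNorm φ 2 m).toReal ∧ ‖φ‖ ≤ C₂') →
      SidonSystem.IsTensorSidonSet 4 (Λ₁ ∪ Λ₂) C := by
  -- A negative Sidon constant is possible for the empty set, hence the 0.
  set C := max (max C₁ C₂) 0 with hC
  set D := max C₁' C₂' with hD
  have hC0 : 0 ≤ C := le_max_right _ _
  have hD0 : 0 < D := hC₁'.trans_le (le_max_left _ _)
  have hK0 : 0 < C + 1 := by linarith
  set a := δ ^ 4 / D ^ 2 with ha
  have ha0 : 0 < a := by positivity
  set b := ((C + 1) * D) ^ 2 * D ^ 2 with hb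
  have hb0 : 0 < b := by positivity
  -- The two symmetric estimates have total error 4 η² b R, where R is the sum of all coefficients;
  -- as η² ≤ η, this choice makes it at most (a / 2) R.
  set η := min 1 (a / (8 * b)) with hη
  have hη0 : 0 < η := lt_min one_pos (by positivity)
  have hη1 : η ≤ 1 := min_le_left _ _
  have hηb : 4 * η ^ 2 * b ≤ a / 2 := by
    have h1 : η * (8 * b) ≤ a := (le_div_iff₀ (by positivity)).1 (min_le_right _ _)
    have h2 : η ^ 2 ≤ η := by rw [sq]; exact mul_le_of_le_one_left hη0.le hη1
    nlinarith
  refine ⟨8 * η⁻¹ * (C + 1) ^ 2 / a, ?_⟩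
  intro T _ m _ Λ₁ Λ₂ h₁ h₂ horth hb₁ hb₂
  refine ⟨h₁.1.union h₂.1, fun x => ?_⟩
  classical
  set X : Lp ℂ ∞ m → ℂ := Function.extend Subtype.val x 0 with hX
  have hXx : ∀ i : ↥(Λ₁ ∪ Λ₂), X i = x i := fun i => Subtype.val_injective.extend_apply _ _ i
  set s : Finset (Lp ℂ ∞ m) := x.support.map (Function.Embedding.subtype _) with hs
  have hsU : ∀ φ ∈ s, φ ∈ Λ₁ ∨ φ ∈ Λ₂ := by
    intro φ hφ
    obtain ⟨i, -, rfl⟩ := Finset.mem_map.1 hφ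
    exact i.2
  have e1 : ∑ i ∈ x.support, ‖x i‖ = ∑ φ ∈ s, ‖X φ‖ := by
    simp [hs, hXx]
  have e2 : ∑ i ∈ x.support, x i • SidonSystem.tensorPow 4 (i : Lp ℂ ∞ m) =
      ∑ φ ∈ s, X φ • SidonSystem.tensorPow 4 φ := by
    simp [hs, hXx]
  have hbound : ∀ φ ∈ s, ‖φ‖ ≤ D := by
    intro φ hφ
    rcases hsU φ hφ with h | h
    · exact (hb₁ φ h).2.trans (le_max_left _ _)
    · exact (hb₂ φ h).2.trans (le_max_right _ _)
  set s₁ := s.filter (· ∈ Λ₁) with hs₁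
  set s₂ := s.filter (· ∈ Λ₂) with hs₂
  have mem₁ : ∀ φ ∈ s₁, φ ∈ Λ₁ := fun φ hφ => (Finset.mem_filter.1 hφ).2
  have mem₂ : ∀ φ ∈ s₂, φ ∈ Λ₂ := fun φ hφ => (Finset.mem_filter.1 hφ).2
  have key₁ := SidonSystem.sum_norm_le_norm_sum_tensorPow_add (Finset.filter_subset _ s) hC0 hD0
    hδ hη0 hη1 (h₁.sum_norm_le ((le_max_left _ _).trans (le_max_left _ _)) mem₁) hbound
    (fun φ hφ => (hb₁ φ (mem₁ φ hφ)).1) (fun φ hφ ψ hψ hψ' => horth.symm ψ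
      ((hsU ψ hψ).resolve_left fun h => hψ' (Finset.mem_filter.2 ⟨hψ, h⟩)) φ (mem₁ φ hφ)) X
  have key₂ := SidonSystem.sum_norm_le_norm_sum_tensorPow_add (Finset.filter_subset _ s) hC0 hD0
    hδ hη0 hη1 (h₂.sum_norm_le ((le_max_right _ _).trans (le_max_left _ _)) mem₂) hbound
    (fun φ hφ => (hb₂ φ (mem₂ φ hφ)).1) (fun φ hφ ψ hψ hψ' => horth ψ
      ((hsU ψ hψ).resolve_right fun h => hψ' (Finset.mem_filter.2 ⟨hψ, h⟩)) φ (mem₂ φ hφ)) X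
  -- An overlap would merely be counted twice, so disjointness plays no role.
  have hsplit : ∑ φ ∈ s, ‖X φ‖ ≤ ∑ φ ∈ s₁, ‖X φ‖ + ∑ φ ∈ s₂, ‖X φ‖ := by
    rw [← Finset.sum_union_inter]
    refine le_add_of_le_of_nonneg (Finset.sum_le_sum_of_subset_of_nonneg (fun φ hφ => ?_)
      fun _ _ _ => norm_nonneg _) (Finset.sum_nonneg fun _ _ => norm_nonneg _)
    rw [Finset.mem_union, Finset.mem_filter, Finset.mem_filter]
    exact (hsU φ hφ).imp (⟨hφ, ·⟩) (⟨hφ, ·⟩)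
  rw [e1, e2]
  set M := ‖∑ φ ∈ s, X φ • SidonSystem.tensorPow 4 φ‖
  set R := ∑ φ ∈ s, ‖X φ‖ 
  have hR0 : 0 ≤ R := Finset.sum_nonneg fun _ _ => norm_nonneg _
  have h3 : a * R ≤ 4 * η⁻¹ * (C + 1) ^ 2 * M + 4 * η ^ 2 * b * R := by
    have := mul_le_mul_of_nonneg_left hsplit ha0.le
    rw [hb]
    linarith
  have h4 : 4 * η ^ 2 * b * R ≤ a / 2 * R := mul_le_mul_of_nonneg_right hηb hR0
  rw [div_mul_eq_mul_div, le_div_iff₀ ha0]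
  linarith
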